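/- Let $K$ be a finite field of characteristic $2$ (that is, $K=\mathbb{F}_{2^m}$ for some $m\ge 1$), let $f\in K[x]$ be a polynomial and let $d$ be its degree (with $d=0$ if $f=0$). For every polynomial $g\in K[x]$ the polynomial $g(x_0)+g(x_1)+g(x_2)+g(x_0+x_1+x_2)$ is divisible by $(x_0+x_1)(x_2+x_1)(x_0+x_2)$ in $K[x_0,x_1,x_2]$; write $$\phi_g=\frac{g(x_0)+g(x_1)+g(x_2)+g(x_0+x_1+x_2)}{(x_0+x_1)(x_2+x_1)(x_0+x_2)}$$ for the quotient. Let $X_\infty\subset\mathbb{P}^2$ be the projective plane curve with equation $$\phi_{x^d}=\frac{x_0^d+x_1^d+x_2^d+(x_0+x_1+x_2)^d}{(x_0+x_1)(x_2+x_1)(x_0+x_2)}=0,$$ and let $\overline{X}\subset\mathbb{P}^3$ be the projective closure of the affine surface $X:\ \phi_f(x_0,x_1,x_2)=0$, with homogeneous equation $z^{\deg\phi_f}\,\phi_f(x_0/z,x_1/z,x_2/z)=0$ (and $0=0$ if $\phi_f=0$). A singular point of a projective hypersurface $G=0$ is a point of projective space over the algebraic closure $\overline{K}$ at which $G$ and all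 its partial derivatives vanish, and the hypersurface is smooth if it has no singular point. Suppose that $X_\infty$ is smooth. Then $\overline{X}$ has only isolated singular points: every singular point of $\overline{X}$ has a Zariski open neighbourhood in $\mathbb{P}^3$ that contains no other singular point of $\overline{X}$; moreover, $\overline{X}$ has only finitely many singular points. -/

import Mathlib

namespace APN

open MvPolynomial

noncomputable section

/-- The polynomial `f(x₀) + f(x₁) + f(x₂) + f(x₀ + x₁ + x₂)`. -/
def numerator {K : Type*} [Field K] (f : Polynomial K) : MvPolynomial (Fin 3) K :=
  Polynomial.aeval (X 0) f + Polynomial.aeval (X 1) f + Polynomial.aeval (X 2) f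
    + Polynomial.aeval (X 0 + X 1 + X 2) f

/-- The polynomial `(x₀ + x₁)(x₂ + x₁)(x₀ + x₂)`. -/
def denominator (K : Type*) [Field K] : MvPolynomial (Fin 3) K :=
  (X 0 + X 1) * (X 2 + X 1) * (X 0 + X 2)

theorem dvd_sum_pow {R : Type*} [CommRing R] [CharP R 2] (x y z : R) (r : ℕ) :
    (x + y) * (z + y) * (x + z) ∣ x ^ r + y ^ r + z ^ r + (x + y + z) ^ r := by
  have h2 : (2 : R) = 0 := by exact_mod_cast CharP.cast_eq_zero R 2
  induction r using Nat.strong_induction_on with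
  | _ r ih =>
    match r, ih with
    | 0, _ => exact ⟨0, by linear_combination 2 * h2⟩
    | 1, _ => exact ⟨0, by linear_combination (x + y + z) * h2⟩
    | 2, _ => exact ⟨0, by
        linear_combination (x ^ 2 + y ^ 2 + z ^ 2 + x * y + y * z + x * z) * h2⟩
    | 3, _ => exact ⟨1, by
        linear_combination (x ^ 3 + y ^ 3 + z ^ 3 + x ^ 2 * y + x ^ 2 * z + y ^ 2 * x
          + y ^ 2 * z + z ^ 2 * x + z ^ 2 * y + 2 * x * y * z) * h2⟩
    | r + 4, ih =>
      obtain ⟨a, ha⟩ := ih (r + 2) (by omega)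
      obtain ⟨b, hb⟩ := ih (r + 1) (by omega)
      obtain ⟨c, hc⟩ := ih r (by omega)
      obtain ⟨s, hs⟩ := ih (r + 3) (by omega)
      refine ⟨2 * (x + y + z) * s
        - (x * y + y * z + x * z + (x + y + z) ^ 2) * a
        + (x * y * z + (x * y + y * z + x * z) * (x + y + z)) * b
        - x * y * z * (x + y + z) * c, ?_⟩
      linear_combination 2 * (x + y + z) * hs
        - (x * y + y * z + x * z + (x + y + z) ^ 2) * ha
        + (x * y * z + (x * y + y * z + x * z) * (x + y + z)) * hb
        - x * y * z * (x + y + z) * hc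

theorem denominator_dvd_numerator {K : Type*} [Field K] [CharP K 2] (f : Polynomial K) :
    denominator K ∣ numerator f := by
  have hadd : ∀ p q : Polynomial K, numerator (p + q) = numerator p + numerator q := by
    intro p q
    simp only [numerator, map_add]
    ring
  induction f using Polynomial.induction_on' with
  | add p q hp hq => rw [hadd]; exact dvd_add hp hq
  | monomial n a =>
    have h := (dvd_sum_pow (X 0 : MvPolynomial (Fin 3) K) (X 1) (X 2) n).mul_left (C a)
    simpa only [numerator, denominator, Polynomial.aeval_monomial, algebraMap_eq, mul_add]
      using h

/-- The quotient polynomial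
`(f(x₀) + f(x₁) + f(x₂) + f(x₀ + x₁ + x₂)) / ((x₀ + x₁)(x₂ + x₁)(x₀ + x₂))`. -/
def quotient {K : Type*} [Field K] [CharP K 2] (f : Polynomial K) : MvPolynomial (Fin 3) K :=
  Classical.choose (denominator_dvd_numerator f)

theorem denominator_mul_quotient {K : Type*} [Field K] [CharP K 2] (f : Polynomial K) :
    denominator K * quotient f = numerator f :=
  (Classical.choose_spec (denominator_dvd_numerator f)).symm

/-- The homogenization `z ^ (deg p) * p (x₀ / z, …, xₙ₋₁ / z)` of `p`; the new variable `z` is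
the last one. Its zero locus is the projective closure of the affine hypersurface `p = 0`. -/
def homogenize {K : Type*} [Field K] {n : ℕ} (p : MvPolynomial (Fin n) K) :
    MvPolynomial (Fin (n + 1)) K :=
  ∑ s ∈ p.support, C (p.coeff s) * (∏ i, X (Fin.castSucc i) ^ s i)
    * X (Fin.last n) ^ (p.totalDegree - s.degree)

/-- The geometric points of projective space over `K` with homogeneous coordinates indexed
by `Fin n`, that is, of the projective space of dimension `n - 1`. -/
abbrev ProjPoint (K : Type*) [Field K] (n : ℕ) : Type _ :=
  Projectivization (AlgebraicClosure K) (Fin n → AlgebraicClosure K)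

/-- The singular geometric points of the projective hypersurface with homogeneous equation
`G = 0`: those where `G` and all its partial derivatives vanish. -/
def singularLocus {K : Type*} [Field K] {n : ℕ} (G : MvPolynomial (Fin n) K) :
    Set (ProjPoint K n) :=
  {P | aeval P.rep G = 0 ∧ ∀ i, aeval P.rep (pderiv i G) = 0}

/-- The projective hypersurface `G = 0` is smooth. -/
def IsSmoothHypersurface {K : Type*} [Field K] {n : ℕ} (G : MvPolynomial (Fin n) K) : Prop :=
  singularLocus G = ∅

/-- `P` is an isolated point of `S` for the Zariski topology: some basic open set `H ≠ 0`, with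
`H` homogeneous, contains `P` and no other point of `S`. -/
def IsIsolatedIn {K : Type*} [Field K] {n : ℕ} (P : ProjPoint K n)
    (S : Set (ProjPoint K n)) : Prop :=
  P ∈ S ∧ ∃ (e : ℕ) (H : MvPolynomial (Fin n) (AlgebraicClosure K)), H.IsHomogeneous e ∧
    eval P.rep H ≠ 0 ∧ ∀ Q ∈ S, eval Q.rep H ≠ 0 → Q = P

/-- The homogeneous equation, in the coordinates `x₀, x₁, x₂`, of the plane curve attached
to the degree `d`. -/
def curveAtInfinity (K : Type*) [Field K] [CharP K 2] (d : ℕ) : MvPolynomial (Fin 3) K :=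
  quotient (Polynomial.X ^ d)

/-- The homogeneous equation, in the coordinates `x₀, x₁, x₂, z`, of the projective surface
attached to `f`. -/
def projectiveSurface {K : Type*} [Field K] [CharP K 2] (f : Polynomial K) :
    MvPolynomial (Fin 4) K :=
  homogenize (quotient f)

end

end APN

namespace APN

open MvPolynomial

noncomputable section

/-! The form of degree `d - 3` in `φ_f` is the leading coefficient of `f` times `φ_{x^d}`
(`homogeneousComponent_quotient`), and smoothness forces `φ_{x^d} ≠ 0`; so `X_∞` is the section of
the surface by the plane `z = 0`. It remains to show that a hypersurface whose section at infinity
is smooth has finitely many singular points (`finite_singularLocus_homogenize`). On `z = 0` a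
singular point would be singular on the section, so there is none. The affine ones are the common
zeros of `φ_f` and its partials, whose forms of expected top degree have only the trivial common
zero; by the Nullstellensatz and a degree reduction (`finite_common_zeros`) there are finitely many.
Points of a finite set are isolated. -/

/-- Multiplication by a form of degree `e` shifts homogeneous components by `e`. -/
theorem homogeneousComponent_mul_of_isHomogeneous {R σ : Type*} [CommSemiring R]
    {h : MvPolynomial σ R} {e : ℕ} (hh : h.IsHomogeneous e) (a : MvPolynomial σ R) (N : ℕ) :
    homogeneousComponent N (a * h) =
      if e ≤ N then homogeneousComponent (N - e) a * h else 0 := by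
  induction a using MvPolynomial.induction_on' with
  | monomial s r =>
    rw [homogeneousComponent_of_mem ((isHomogeneous_monomial r rfl).mul hh),
      homogeneousComponent_of_mem (isHomogeneous_monomial r rfl)]
    split_ifs <;> first | rfl | omega
  | add p q hp hq =>
    rw [add_mul, map_add, map_add, hp, hq]
    split_ifs
    · rw [add_mul]
    · rw [add_zero]

/-! ### Finiteness of affine zero sets from leading forms -/

section AffineFiniteness

variable {k L σ ι : Type*} [Field k] [Field L] [Algebra k L]

/-- If modulo `I` every `X i ^ N` is a combination of monomials of degree less than `N`, then the
quotient by `I` is finite-dimensional. -/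
theorem finite_quotient_of_X_pow_sub_mem [Finite σ] (I : Ideal (MvPolynomial σ k)) (N : ℕ)
    (b : σ → MvPolynomial σ k) (hb : ∀ i, X i ^ N - b i ∈ I)
    (hdeg : ∀ i, ∀ s ∈ (b i).support, s.degree < N) :
    Module.Finite k (MvPolynomial σ k ⧸ I) := by
  let T : Set (σ →₀ ℕ) := {s | ∀ i, s i < N}
  have hT : T.Finite := by
    refine Set.Finite.of_injOn (f := fun s : σ →₀ ℕ => (s : σ → ℕ))
      (t := Set.pi Set.univ fun _ => Set.Iio N) ?_ DFunLike.coe_injective.injOn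
      (Set.Finite.pi fun _ => Set.finite_Iio N)
    intro s hs i _
    exact hs i
  let m : (σ →₀ ℕ) → MvPolynomial σ k ⧸ I := fun s => Ideal.Quotient.mk I (monomial s 1)
  have expand : ∀ (V : Submodule k (MvPolynomial σ k ⧸ I)) (p : MvPolynomial σ k),
      (∀ s ∈ p.support, m s ∈ V) → Ideal.Quotient.mk I p ∈ V := by
    intro V p hp
    rw [p.as_sum, map_sum]
    refine V.sum_mem fun s hs => ?_
    have : monomial s (coeff s p) = coeff s p • monomial s (1 : k) := by
      rw [smul_monomial, smul_eq_mul, mul_one]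
    rw [this]
    exact V.smul_mem (coeff s p) (hp s hs)
  have key : ∀ (n : ℕ) (s : σ →₀ ℕ), s.degree = n → m s ∈ Submodule.span k (m '' T) := by
    intro n
    induction n using Nat.strong_induction_on with
    | _ n ih =>
      intro s hs
      by_cases hsT : s ∈ T
      · exact Submodule.subset_span ⟨s, hsT, rfl⟩
      · simp only [T, Set.mem_ofPred_eq, not_forall, not_lt] at hsT
        obtain ⟨i, hi⟩ := hsT
        have hle : Finsupp.single i N ≤ s := by simpa using hi
        obtain ⟨t, rfl⟩ := exists_add_of_le hle
        -- Trading the factor `X i ^ N` for `b i` strictly lowers the degree, so induction on the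
        -- degree applies.
        have h1 : m (Finsupp.single i N + t) = Ideal.Quotient.mk I (b i * monomial t 1) := by
          refine Ideal.Quotient.eq.2 ?_
          have h2 := I.mul_mem_right (monomial t 1) (hb i)
          rwa [sub_mul, X_pow_eq_monomial, monomial_mul, one_mul] at h2
        rw [h1]
        refine expand _ _ fun u hu => ?_
        classical
        have hu' := support_mul (b i) (monomial t (1 : k)) hu
        obtain ⟨v, hv, w, hw, rfl⟩ := Finset.mem_add.1 hu'
        have hw' : w = t := by simpa using support_monomial_subset hw
        subst hw'
        refine ih _ ?_ _ rfl
        have := hdeg i v hv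
        rw [← hs]
        simp only [map_add, Finsupp.degree_single]
        omega
  refine ⟨Submodule.fg_def.2 ⟨m '' T, hT.image m, ?_⟩⟩
  rw [eq_top_iff]
  rintro x -
  obtain ⟨p, rfl⟩ := Ideal.Quotient.mk_surjective x
  exact expand _ p fun s _ => key _ s rfl

/-- The class of each `X i` is integral over `k`, so each coordinate of a zero is a root of a fixed
monic polynomial. -/
theorem finite_zeroLocus_of_finite_quotient [Finite σ] (I : Ideal (MvPolynomial σ k))
    [Module.Finite k (MvPolynomial σ k ⧸ I)] : (zeroLocus L I).Finite := by
  have hint : ∀ i, IsIntegral k (Ideal.Quotient.mk I (X i)) := fun i =>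
    Algebra.IsIntegral.isIntegral _
  choose q hq hq0 using hint
  refine (Set.Finite.pi fun i => ((q i).map (algebraMap k L)).rootSet_finite L).subset ?_
  intro x hx i _
  rw [Polynomial.mem_rootSet]
  refine ⟨((hq i).map _).ne_zero, ?_⟩
  let ψ : MvPolynomial σ k ⧸ I →ₐ[k] L := Ideal.Quotient.liftₐ I (aeval x) hx
  have h1 : ψ (Ideal.Quotient.mk I (X i)) = x i := by
    change aeval x (X i) = x i
    simp
  have h2 : Polynomial.aeval (Ideal.Quotient.mk I (X i)) (q i) = 0 := hq0 i
  have h3 := congrArg ψ h2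
  rw [← Polynomial.aeval_algHom_apply, h1, map_zero] at h3
  rwa [Polynomial.aeval_map_algebraMap]

/-- If the leading forms of finitely many polynomials have no nontrivial common zero, then the
polynomials have finitely many common zeros. -/
theorem finite_common_zeros [IsAlgClosed L] [Finite σ] [Finite ι]
    (F h : ι → MvPolynomial σ k) (e : ι → ℕ) (hh : ∀ j, (h j).IsHomogeneous (e j))
    (hF : ∀ j, ∀ s ∈ (F j - h j).support, s.degree < e j)
    (hz : ∀ x : σ → L, (∀ j, aeval x (h j) = 0) → x = 0) :
    {x : σ → L | ∀ j, aeval x (F j) = 0}.Finite := by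
  cases nonempty_fintype ι
  cases nonempty_fintype σ
  have hrad : ∀ i, X i ∈ (Ideal.span (Set.range h)).radical := by
    intro i
    rw [← vanishingIdeal_zeroLocus_eq_radical (K := L), mem_vanishingIdeal_iff, zeroLocus_span]
    intro x hx
    rw [aeval_X, hz x fun j => hx _ ⟨j, rfl⟩]
    rfl
  choose N₀ hN₀ using hrad
  let N := ∑ i, N₀ i
  have hmem : ∀ i, X i ^ N ∈ Ideal.span (Set.range h) := fun i =>
    Ideal.pow_mem_of_pow_mem _ (hN₀ i) (Finset.single_le_sum (fun _ _ => Nat.zero_le _)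
      (Finset.mem_univ i))
  have hcomb : ∀ i, ∃ a : ι → MvPolynomial σ k, ∑ j, a j * h j = X i ^ N := fun i =>
    (Ideal.mem_span_range_iff_exists_fun).1 (hmem i)
  choose a ha using hcomb
  -- Keeping only the components of degree `N - e j` makes the relation homogeneous: replacing `h j`
  -- by `F j` then changes it only in degrees below `N`. The test `e j ≤ N` guards the truncated
  -- subtraction.
  let c : σ → ι → MvPolynomial σ k := fun i j =>
    if e j ≤ N then homogeneousComponent (N - e j) (a i j) else 0
  have hc : ∀ i, ∑ j, c i j * h j = X i ^ N := by
    intro i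
    have h1 := congrArg (homogeneousComponent N) (ha i)
    rw [homogeneousComponent_eq_self (isHomogeneous_X_pow i N), map_sum] at h1
    rw [← h1]
    refine Finset.sum_congr rfl fun j _ => ?_
    simp only [c, homogeneousComponent_mul_of_isHomogeneous (hh j), ite_mul, zero_mul]
  let I := Ideal.span (Set.range F)
  have : Module.Finite k (MvPolynomial σ k ⧸ I) := by
    refine finite_quotient_of_X_pow_sub_mem I N (fun i => X i ^ N - ∑ j, c i j * F j) ?_ ?_
    · intro i
      rw [sub_sub_cancel]
      exact I.sum_mem fun j _ => I.mul_mem_left _ (Ideal.subset_span ⟨j, rfl⟩)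
    · intro i s hs
      classical
      have h1 : X i ^ N - ∑ j, c i j * F j = - ∑ j, c i j * (F j - h j) := by
        simp only [mul_sub, Finset.sum_sub_distrib, hc]
        ring
      rw [h1, support_neg] at hs
      obtain ⟨j, -, hj⟩ := Finset.mem_biUnion.1 (support_sum hs)
      obtain ⟨u, hu, v, hv, rfl⟩ := Finset.mem_add.1 (support_mul _ _ hj)
      have hv' := hF j v hv
      by_cases hN : e j ≤ N
      · simp only [c, if_pos hN] at hu
        have hu' : u.degree = N - e j :=
          homogeneousComponent_isHomogeneous _ (a i j) |>.degree_eq_sum_deg_support hu |>.symm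
        rw [map_add]
        omega
      · simp [c, if_neg hN] at hu
  refine (finite_zeroLocus_of_finite_quotient (L := L) I).subset ?_
  intro x hx
  rw [zeroLocus_span]
  rintro _ ⟨j, rfl⟩
  exact hx j

end AffineFiniteness

/-! ### Singular points of projective closures, and isolation -/

section Projective

variable {K : Type*} [Field K]

theorem aeval_smul_of_isHomogeneous {σ L : Type*} [Field L] [Algebra K L]
    {G : MvPolynomial σ K} {e : ℕ} (hG : G.IsHomogeneous e) (a : L) (x : σ → L) :
    aeval (a • x) G = a ^ e * aeval x G := by
  rw [aeval_def, aeval_def, eval₂_eq, eval₂_eq, Finset.mul_sum]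
  refine Finset.sum_congr rfl fun s hs => ?_
  rw [hG.degree_eq_sum_deg_support hs, ← Finset.prod_pow_eq_pow_sum]
  simp only [Pi.smul_apply, smul_eq_mul, mul_pow, Finset.prod_mul_distrib]
  ring

theorem homogenize_isHomogeneous {n : ℕ} (p : MvPolynomial (Fin n) K) :
    (homogenize p).IsHomogeneous p.totalDegree := by
  refine IsHomogeneous.sum _ _ _ fun s hs => ?_
  have h1 : (∏ i, (X (Fin.castSucc i) : MvPolynomial (Fin (n + 1)) K) ^ s i).IsHomogeneous
      s.degree := by
    rw [Finsupp.degree_eq_sum]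
    exact IsHomogeneous.prod _ _ _ fun i _ => isHomogeneous_X_pow _ _
  have h2 : s.degree ≤ p.totalDegree := le_totalDegree hs
  have h3 := (h1.C_mul (p.coeff s)).mul
    (isHomogeneous_X_pow (R := K) (Fin.last n) (p.totalDegree - s.degree))
  rwa [Nat.add_sub_cancel' h2] at h3

/-- Substitution of a constant for the last variable. -/
def specializeLast {n : ℕ} (c : K) : MvPolynomial (Fin (n + 1)) K →ₐ[K] MvPolynomial (Fin n) K :=
  aeval (Fin.snoc (α := fun _ => MvPolynomial (Fin n) K) X (C c))

@[simp]
theorem specializeLast_X_castSucc {n : ℕ} (c : K) (i : Fin n) :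
    specializeLast c (X i.castSucc) = X i := by
  simp [specializeLast]

@[simp]
theorem specializeLast_X_last {n : ℕ} (c : K) :
    specializeLast c (X (Fin.last n)) = C c := by
  simp [specializeLast]

theorem pderiv_specializeLast {n : ℕ} (c : K) (i : Fin n) (q : MvPolynomial (Fin (n + 1)) K) :
    pderiv i (specializeLast c q) = specializeLast c (pderiv i.castSucc q) := by
  induction q using MvPolynomial.induction_on with
  | C a => simp [specializeLast]
  | add p q hp hq => simp only [map_add, hp, hq]
  | mul_X p j hp =>
    have hX : pderiv i (specializeLast c (X j)) =
        specializeLast c (pderiv i.castSucc (X j : MvPolynomial (Fin (n + 1)) K)) := by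
      induction j using Fin.lastCases with
      | last => simp [pderiv_X_of_ne (Fin.castSucc_lt_last i).ne']
      | cast j =>
        by_cases hij : j = i
        · subst hij; simp
        · have : j.castSucc ≠ i.castSucc := fun h => hij (Fin.castSucc_injective _ h)
          simp [pderiv_X_of_ne hij, pderiv_X_of_ne this]
    simp only [map_mul, pderiv_mul, map_add, hp, hX]

theorem aeval_specializeLast {n : ℕ} {L : Type*} [Field L] [Algebra K L] (v : Fin (n + 1) → L)
    (c : K) (hv : v (Fin.last n) = algebraMap K L c) (q : MvPolynomial (Fin (n + 1)) K) :
    aeval (fun i : Fin n => v i.castSucc) (specializeLast c q) = aeval v q := by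
  rw [← AlgHom.comp_apply]
  congr 1
  ext j
  induction j using Fin.lastCases with
  | last => simp [hv]
  | cast j => simp

theorem specializeLast_one_homogenize {n : ℕ} (p : MvPolynomial (Fin n) K) :
    specializeLast 1 (homogenize p) = p := by
  conv_rhs => rw [p.as_sum]
  rw [homogenize, map_sum]
  refine Finset.sum_congr rfl fun s _ => ?_
  rw [monomial_eq, Finsupp.prod_fintype _ _ (by simp)]
  simp only [map_mul, map_prod, map_pow, specializeLast_X_castSucc, specializeLast_X_last, map_one,
    one_pow, mul_one]
  simp [specializeLast]

theorem specializeLast_zero_homogenize {n : ℕ} (p : MvPolynomial (Fin n) K) :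
    specializeLast 0 (homogenize p) = homogeneousComponent p.totalDegree p := by
  rw [homogeneousComponent_apply, homogenize, map_sum, Finset.sum_filter]
  refine Finset.sum_congr rfl fun s hs => ?_
  have h2 : s.degree ≤ p.totalDegree := le_totalDegree hs
  rw [monomial_eq, Finsupp.prod_fintype _ _ (by simp)]
  simp only [map_mul, map_prod, map_pow, specializeLast_X_castSucc, specializeLast_X_last, map_zero]
  split_ifs with h
  · rw [h, Nat.sub_self, pow_zero, mul_one]
    simp [specializeLast]
  · rw [zero_pow (by omega), mul_zero]

/-- Smoothness read on the affine cone; homogeneity makes the choice of representative irrelevant.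
-/
theorem eq_zero_of_isSmoothHypersurface {n : ℕ} {G : MvPolynomial (Fin n) K} {e : ℕ}
    (hG : G.IsHomogeneous e) (hs : IsSmoothHypersurface G) (x : Fin n → AlgebraicClosure K)
    (h0 : aeval x G = 0) (h1 : ∀ i, aeval x (pderiv i G) = 0) : x = 0 := by
  by_contra hx
  have hmem : Projectivization.mk (AlgebraicClosure K) x hx ∈ singularLocus G := by
    obtain ⟨a, ha⟩ := Projectivization.exists_smul_eq_mk_rep (AlgebraicClosure K) x hx
    rw [Units.smul_def] at ha
    refine ⟨?_, fun i => ?_⟩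
    · rw [← ha, aeval_smul_of_isHomogeneous hG, h0, mul_zero]
    · rw [← ha, aeval_smul_of_isHomogeneous hG.pderiv, h1, mul_zero]
  rw [hs] at hmem
  exact hmem

theorem degree_lt_of_mem_support_pderiv {σ R : Type*} [CommSemiring R] {p : MvPolynomial σ R}
    {D : ℕ} (hp : ∀ s ∈ p.support, s.degree < D) (i : σ) :
    ∀ s ∈ (pderiv i p).support, s.degree < D - 1 := by
  intro s hs
  rw [mem_support_iff, coeff_pderiv] at hs
  have := hp (s + Finsupp.single i 1) (mem_support_iff.2 (left_ne_zero_of_mul hs))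
  rw [map_add, Finsupp.degree_single] at this
  omega

theorem degree_lt_of_mem_support_sub_top {σ R : Type*} [CommRing R] (p : MvPolynomial σ R) :
    ∀ s ∈ (p - homogeneousComponent p.totalDegree p).support, s.degree < p.totalDegree := by
  intro s hs
  rw [mem_support_iff, coeff_sub, coeff_homogeneousComponent] at hs
  split_ifs at hs with h
  · simp at hs
  · rw [sub_zero] at hs
    exact lt_of_le_of_ne (le_totalDegree (mem_support_iff.2 hs)) h

/-- A hypersurface with smooth intersection with the hyperplane at infinity has finitely many
singular points. -/
theorem finite_singularLocus_homogenize {n : ℕ} (p : MvPolynomial (Fin n) K)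
    (hs : IsSmoothHypersurface (homogeneousComponent p.totalDegree p)) :
    (singularLocus (homogenize p)).Finite := by
  let h := homogeneousComponent p.totalDegree p
  have hh : h.IsHomogeneous p.totalDegree := homogeneousComponent_isHomogeneous _ _
  have hzero : ∀ x : Fin n → AlgebraicClosure K, aeval x h = 0 →
      (∀ i, aeval x (pderiv i h) = 0) → x = 0 :=
    eq_zero_of_isSmoothHypersurface hh hs
  have hfin : {x : Fin n → AlgebraicClosure K | ∀ j : Option (Fin n),
      aeval x (j.elim p fun i => pderiv i p) = 0}.Finite := by
    refine finite_common_zeros (fun j : Option (Fin n) => j.elim p fun i => pderiv i p)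
      (fun j => j.elim h fun i => pderiv i h)
      (fun j => j.elim p.totalDegree fun _ => p.totalDegree - 1) ?_ ?_ ?_
    · rintro (_ | i)
      · exact hh
      · exact hh.pderiv
    · rintro (_ | i)
      · exact degree_lt_of_mem_support_sub_top p
      · simp only [Option.elim_some, ← map_sub]
        exact degree_lt_of_mem_support_pderiv (degree_lt_of_mem_support_sub_top p) i
    · intro x hx
      exact hzero x (hx none) fun i => hx (some i)
  -- No singular point lies at infinity: setting the last variable to 0 commutes with the other
  -- partials and leaves the top form.
  have hlast : ∀ P ∈ singularLocus (homogenize p), P.rep (Fin.last n) ≠ 0 := by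
    intro P hP hP0
    have hv : P.rep (Fin.last n) = algebraMap K (AlgebraicClosure K) 0 := by rw [hP0, map_zero]
    have hx := hzero (fun i => P.rep i.castSucc)
      (by rw [← hP.1, ← aeval_specializeLast P.rep 0 hv, specializeLast_zero_homogenize])
      (fun i => by
        rw [← hP.2 i.castSucc, ← aeval_specializeLast P.rep 0 hv, ← pderiv_specializeLast,
          specializeLast_zero_homogenize])
    refine P.rep_nonzero (funext fun j => ?_)
    induction j using Fin.lastCases with
    | last => exact hP0
    | cast j => exact congrFun hx j
  -- Dehomogenization embeds the singular points into the finite affine set.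
  refine Set.Finite.of_injOn
    (f := fun P => fun i : Fin n => (P.rep (Fin.last n))⁻¹ * P.rep i.castSucc) ?_ ?_ hfin
  · intro P hP
    let w := (P.rep (Fin.last n))⁻¹ • P.rep
    have hw : w (Fin.last n) = algebraMap K (AlgebraicClosure K) 1 := by
      rw [map_one]; exact inv_mul_cancel₀ (hlast P hP)
    rintro (_ | i)
    · change aeval (fun i : Fin n => w i.castSucc) p = 0
      conv_lhs => rw [← specializeLast_one_homogenize p]
      rw [aeval_specializeLast w 1 hw, aeval_smul_of_isHomogeneous (homogenize_isHomogeneous p),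
        hP.1, mul_zero]
    · change aeval (fun i : Fin n => w i.castSucc) (pderiv i p) = 0
      conv_lhs => rw [← specializeLast_one_homogenize p]
      rw [pderiv_specializeLast, aeval_specializeLast w 1 hw,
        aeval_smul_of_isHomogeneous (homogenize_isHomogeneous p).pderiv, hP.2, mul_zero]
  · intro P hP Q hQ hPQ
    have hP0 := hlast P hP
    have hQ0 := hlast Q hQ
    rw [← P.mk_rep, ← Q.mk_rep, Projectivization.mk_eq_mk_iff']
    refine ⟨P.rep (Fin.last n) * (Q.rep (Fin.last n))⁻¹, funext fun j => ?_⟩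
    rw [Pi.smul_apply, smul_eq_mul]
    induction j using Fin.lastCases with
    | last => field_simp
    | cast j =>
      have h1 : (P.rep (Fin.last n))⁻¹ * P.rep j.castSucc =
        (Q.rep (Fin.last n))⁻¹ * Q.rep j.castSucc := congrFun hPQ j
      rw [mul_assoc, ← h1, mul_inv_cancel_left₀ hP0]

theorem exists_linear_form {n : ℕ} {P Q : ProjPoint K n} (hPQ : P ≠ Q) :
    ∃ H : MvPolynomial (Fin n) (AlgebraicClosure K), H.IsHomogeneous 1 ∧
      eval P.rep H ≠ 0 ∧ eval Q.rep H = 0 := by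
  obtain ⟨i, hi⟩ := Function.ne_iff.1 Q.rep_nonzero
  rw [Pi.zero_apply] at hi
  -- If all these minors vanished, the two representatives would be proportional.
  have hj : ∃ j, Q.rep i * P.rep j - Q.rep j * P.rep i ≠ 0 := by
    by_contra! hall
    refine hPQ ?_
    rw [← P.mk_rep, ← Q.mk_rep, Projectivization.mk_eq_mk_iff']
    refine ⟨P.rep i / Q.rep i, funext fun j => ?_⟩
    rw [Pi.smul_apply, smul_eq_mul]
    field_simp
    linear_combination - hall j
  obtain ⟨j, hj⟩ := hj
  refine ⟨C (Q.rep i) * X j - C (Q.rep j) * X i,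
    (isHomogeneous_C_mul_X _ _).sub (isHomogeneous_C_mul_X _ _), ?_, ?_⟩
  · simpa using hj
  · simp [mul_comm]

/-- Multiply linear forms, one for each other point of `S`, vanishing there but not at `P`. -/
theorem isIsolatedIn_of_finite {n : ℕ} {S : Set (ProjPoint K n)} (hS : S.Finite)
    {P : ProjPoint K n} (hP : P ∈ S) : IsIsolatedIn P S := by
  classical
  have hex : ∀ Q : ProjPoint K n, ∃ H : MvPolynomial (Fin n) (AlgebraicClosure K),
      Q ≠ P → H.IsHomogeneous 1 ∧ eval P.rep H ≠ 0 ∧ eval Q.rep H = 0 := by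
    intro Q
    by_cases h : Q = P
    · exact ⟨0, fun h' => absurd h h'⟩
    · obtain ⟨H, hH⟩ := exists_linear_form (Ne.symm h)
      exact ⟨H, fun _ => hH⟩
  choose H hH using hex
  let T := hS.toFinset.erase P
  refine ⟨hP, ∑ Q ∈ T, 1, ∏ Q ∈ T, H Q,
    IsHomogeneous.prod _ _ _ fun Q hQ => (hH Q (Finset.ne_of_mem_erase hQ)).1, ?_, ?_⟩
  · rw [map_prod]
    exact Finset.prod_ne_zero_iff.2 fun Q hQ => (hH Q (Finset.ne_of_mem_erase hQ)).2.1
  · intro Q hQ hne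
    by_contra hQP
    refine hne ?_
    rw [map_prod]
    exact Finset.prod_eq_zero (Finset.mem_erase.2 ⟨hQP, hS.mem_toFinset.2 hQ⟩) (hH Q hQP).2.2

theorem not_isSmoothHypersurface_zero {n : ℕ} :
    ¬ IsSmoothHypersurface (0 : MvPolynomial (Fin (n + 1)) K) := by
  intro h
  have : (Projectivization.mk (AlgebraicClosure K) (fun _ : Fin (n + 1) => 1)
      (fun h => one_ne_zero (congrFun h 0))) ∈ singularLocus (0 : MvPolynomial (Fin (n + 1)) K) :=
    ⟨map_zero _, fun i => by rw [map_zero, map_zero]⟩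
  rw [h] at this
  exact this

theorem singularLocus_C_mul {n : ℕ} {a : K} (ha : a ≠ 0) (G : MvPolynomial (Fin n) K) :
    singularLocus (C a * G) = singularLocus G := by
  ext P
  simp [singularLocus, ha]

end Projective

/-! ### The top form and the degree of `φ_f` -/

section LeadingForm

variable {K : Type*} [Field K]

theorem denominator_isHomogeneous : (denominator K).IsHomogeneous 3 :=
  (((isHomogeneous_X K 0).add (isHomogeneous_X K 1)).mul
    ((isHomogeneous_X K 2).add (isHomogeneous_X K 1))).mul
    ((isHomogeneous_X K 0).add (isHomogeneous_X K 2))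

theorem denominator_ne_zero : denominator K ≠ 0 := by
  have hne : ∀ i j : Fin 3, i ≠ j → (X i + X j : MvPolynomial (Fin 3) K) ≠ 0 := by
    intro i j hij h
    have := congrArg (eval (Pi.single i (1 : K))) h
    simp [hij.symm] at this
  exact mul_ne_zero (mul_ne_zero (hne 0 1 (by decide)) (hne 2 1 (by decide)))
    (hne 0 2 (by decide))

theorem numerator_X_pow_isHomogeneous (n : ℕ) :
    (numerator (Polynomial.X ^ n : Polynomial K)).IsHomogeneous n := by
  have hX : ∀ i : Fin 3, (X i : MvPolynomial (Fin 3) K).IsHomogeneous 1 := isHomogeneous_X K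
  have h := fun {q : MvPolynomial (Fin 3) K} (hq : q.IsHomogeneous 1) => by
    simpa using hq.pow n
  simp only [numerator, map_pow, Polynomial.aeval_X]
  exact (((h (hX 0)).add (h (hX 1))).add (h (hX 2))).add (h (((hX 0).add (hX 1)).add (hX 2)))

theorem homogeneousComponent_numerator (f : Polynomial K) (n : ℕ) :
    homogeneousComponent n (numerator f) = C (f.coeff n) * numerator (Polynomial.X ^ n) := by
  induction f using Polynomial.induction_on' with
  | add p q hp hq =>
    have hadd : numerator (p + q) = numerator p + numerator q := by
      simp only [numerator, map_add]; ring
    rw [hadd, map_add, hp, hq, Polynomial.coeff_add, map_add, add_mul]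
  | monomial m a =>
    have h : numerator (Polynomial.monomial m a) = C a * numerator (Polynomial.X ^ m) := by
      simp only [numerator, Polynomial.aeval_monomial, algebraMap_eq, map_pow, Polynomial.aeval_X]
      ring
    rw [h, homogeneousComponent_C_mul, homogeneousComponent_of_mem (numerator_X_pow_isHomogeneous m),
      Polynomial.coeff_monomial]
    split_ifs with h1 h2 h2
    · rw [h1]
    · exact absurd h1.symm h2
    · exact absurd h2.symm h1
    · simp

variable [CharP K 2]

/-- The denominator is a nonzero cubic form, so it can be cancelled from the degree `n + 3` part of
the numerator. -/
theorem homogeneousComponent_quotient (f : Polynomial K) (n : ℕ) :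
    homogeneousComponent n (quotient f) =
      C (f.coeff (n + 3)) * quotient (Polynomial.X ^ (n + 3)) := by
  refine mul_left_cancel₀ (denominator_ne_zero (K := K)) ?_
  have h1 := homogeneousComponent_mul_of_isHomogeneous denominator_isHomogeneous (quotient f)
    (n + 3)
  rw [mul_comm _ (denominator K), denominator_mul_quotient, if_pos (Nat.le_add_left _ _),
    Nat.add_sub_cancel, homogeneousComponent_numerator, ← denominator_mul_quotient] at h1
  linear_combination - h1

theorem quotient_X_pow_of_lt_three {n : ℕ} (hn : n < 3) :
    quotient (Polynomial.X ^ n : Polynomial K) = 0 := by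
  rw [← sum_homogeneousComponent (quotient (Polynomial.X ^ n : Polynomial K))]
  refine Finset.sum_eq_zero fun m _ => ?_
  rw [homogeneousComponent_quotient, Polynomial.coeff_X_pow, if_neg (by omega), map_zero, zero_mul]

/-- Without `hq` the expected top form could vanish and the degree drop. -/
theorem totalDegree_quotient {f : Polynomial K}
    (hq : quotient (Polynomial.X ^ f.natDegree : Polynomial K) ≠ 0) :
    (quotient f).totalDegree + 3 = f.natDegree := by
  have h3 : 3 ≤ f.natDegree := by
    by_contra! h
    exact hq (quotient_X_pow_of_lt_three h)
  obtain ⟨m, hm⟩ := Nat.exists_eq_add_of_le' h3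
  have hf : f.leadingCoeff ≠ 0 := by
    rw [Polynomial.leadingCoeff_ne_zero]
    rintro rfl
    simp at hm
  have htop : homogeneousComponent m (quotient f) ≠ 0 := by
    rw [homogeneousComponent_quotient, ← hm]
    exact mul_ne_zero (C_ne_zero.2 hf) hq
  have hle : m ≤ (quotient f).totalDegree := by
    by_contra! h
    exact htop (homogeneousComponent_eq_zero _ _ h)
  have hge : (quotient f).totalDegree ≤ m := by
    refine Finset.sup_le fun s hs => ?_
    by_contra! h
    have h1 := congrArg (coeff s) (homogeneousComponent_quotient f s.degree)
    rw [coeff_homogeneousComponent, if_pos rfl,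
      Polynomial.coeff_eq_zero_of_natDegree_lt, map_zero, zero_mul, coeff_zero] at h1
    · exact mem_support_iff.1 hs h1
    · have : m < s.degree := h
      omega
  omega

end LeadingForm

end

end APN

theorem mainTheorem3 {K : Type*} [Field K] [Finite K] [CharP K 2]
    (f : Polynomial K) (d : ℕ) (hd : f.natDegree = d)
    (hsmooth : APN.IsSmoothHypersurface (APN.curveAtInfinity K d)) :
    (APN.singularLocus (APN.projectiveSurface f)).Finite ∧
      ∀ P ∈ APN.singularLocus (APN.projectiveSurface f),
        APN.IsIsolatedIn P (APN.singularLocus (APN.projectiveSurface f)) := by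
  subst hd
  have hq : APN.quotient (Polynomial.X ^ f.natDegree : Polynomial K) ≠ 0 := by
    intro h
    rw [APN.curveAtInfinity, h] at hsmooth
    exact APN.not_isSmoothHypersurface_zero hsmooth
  have hdeg := APN.totalDegree_quotient hq
  have hf : f.leadingCoeff ≠ 0 := by
    rw [Polynomial.leadingCoeff_ne_zero]
    rintro rfl
    simp at hdeg
  have hfin : (APN.singularLocus (APN.projectiveSurface f)).Finite := by
    refine APN.finite_singularLocus_homogenize _ ?_
    rw [APN.homogeneousComponent_quotient, hdeg, APN.IsSmoothHypersurface]
    exact (APN.singularLocus_C_mul hf _).trans hsmooth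
  exact ⟨hfin, fun P hP => APN.isIsolatedIn_of_finite hfin hP⟩
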